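/- For complex numbers $a, q$ and an integer $m \ge 0$ write $(a;q)_m=\prod_{j=0}^{m-1}(1-aq^j)$, and for $|q|<1$ write $(a;q)_\infty=\prod_{j\ge 0}(1-aq^j)$ and $(a_1,a_2,a_3;q)_\infty=(a_1;q)_\infty(a_2;q)_\infty(a_3;q)_\infty$. Then for every complex $q$ with $|q|<1$ the following four double series (over all integers $n,r\ge 0$, with $0^0=1$) converge absolutely, and $$\sum_{n,r\ge 0}\frac{q^{2n^2+3r^2+4nr+2n+3r}}{(-q;q)_{n+r}\,(-q;q)_{n+2r+1}\,(q;q)_r\,(q;q)_n}=\frac{(q,q^8,q^9;q^9)_\infty}{(q^2;q^2)_\infty},$$ $$\sum_{n,r\ge 0}\frac{q^{2n^2+3r^2+4nr+2n+3r}\,\bigl(1+q^{r+1}-q^{n+r+1}+q^{n+2r+1}\bigr)}{(-q;q)_{n+r}\,(-q;q)_{n+2r+1}\,(q;q)_r\,(q;q)_n}=\frac{(q^2,q^7,q^9;q^9)_\infty}{(q^2;q^2)_\infty},$$ $$\sum_{n,r\ge 0}\frac{q^{2n^2+3r^2+4nr+r}\,\bigl(1-q^{n}+q^{n+r}\bigr)}{(-q;q)_{n+r}\,(-q;q)_{n+2r}\,(q;q)_r\,(q;q)_n}=\frac{(q^3;q^3)_\infty}{(q^2;q^2)_\infty},$$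 $$\sum_{n,r\ge 0}\frac{q^{2n^2+3r^2+4nr}}{(-q;q)_{n+r}\,(-q;q)_{n+2r}\,(q;q)_r\,(q;q)_n}=\frac{(q^4,q^5,q^9;q^9)_\infty}{(q^2;q^2)_\infty}.$$ -/

import Mathlib

/-- The finite `q`-shifted factorial `(a;q)_m = ∏_{j=0}^{m-1} (1 - a q^j)`. -/
noncomputable def qPoch (a q : ℂ) (m : ℕ) : ℂ :=
  ∏ j ∈ Finset.range m, (1 - a * q ^ j)

/-- The infinite `q`-shifted factorial `(a;q)_∞ = ∏_{j=0}^∞ (1 - a q^j)`,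
meaningful for `|q| < 1` (see `multipliable_qPochInf`). -/
noncomputable def qPochInf (a q : ℂ) : ℂ :=
  ∏' j : ℕ, (1 - a * q ^ j)

/-- For `|q| < 1` the product defining `(a;q)_∞` converges. -/
theorem multipliable_qPochInf (a q : ℂ) (hq : ‖q‖ < 1) :
    Multipliable (fun j : ℕ => 1 - a * q ^ j) := by
  have h : Summable (fun j : ℕ => -(a * q ^ j)) :=
    ((summable_geometric_of_norm_lt_one hq).mul_left a).neg
  have h2 := Complex.multipliable_one_add_of_summable h
  simpa [sub_eq_add_neg] using h2

/-- `(a₁, a₂, a₃; q)_∞ = (a₁;q)_∞ (a₂;q)_∞ (a₃;q)_∞`. -/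
noncomputable def qPochInf₃ (a₁ a₂ a₃ q : ℂ) : ℂ :=
  qPochInf a₁ q * qPochInf a₂ q * qPochInf a₃ q

section

open Finset Filter Topology

/-! Put `N = n + r`. As `2n² + 3r² + 4nr = 2N² + r²`, each double series is a sum over `N` of
`q^(2N² + 2cN)`, with `c` equal to 0 or 1, times a finite inner sum over `r ≤ N`. A `q`-binomial
transformation turns the inner sums into values of `mixedSum`, divided by `(-q;q)_{2N+c}`
(`sum_eq_mixedSum`, `sum_weighted_eq_mixedSum`).

The rest is a Bailey chain. The quantities `1/(q;q)_m`, `q^m/(q;q)_m` and `(1 + q^(m+1))/(q;q)_m`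
are bilateral sums of `(-1)^k q^(3k(k-1)/2 + bk) / ((q;q)_{m-k} (q;q)_{m+c+k})` with `b = 2, 3, 1`
(`bilSum_three_two` and its two successors). Summing over `m` against the change-of-base kernel
replaces `q` by `q²` in the denominators and adds `k² + ck` to the exponent, so 3 becomes 5
(`bilSum_five`). Summing over `N` with the Durfee rectangle identity in base `q²` adds `2(k² + ck)`,
so 5 becomes 9 (`hasSum_bilSum`).

What remains is `∑ (-1)^k q^(9k(k-1)/2 + Bk)` over `(q²;q²)_∞` with `B = 8, 7, 6, 5`, which Jacobi's
triple product evaluates. For `B = 6` the product collapses to `(q³;q³)_∞`. -/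

/-! ### Finite `q`-factorials and their reciprocals -/

theorem qPoch_zero (a q : ℂ) : qPoch a q 0 = 1 := by simp [qPoch]

theorem qPoch_succ (a q : ℂ) (n : ℕ) : qPoch a q (n + 1) = qPoch a q n * (1 - a * q ^ n) := by
  simp [qPoch, prod_range_succ]

theorem qPoch_add (a q : ℂ) (m n : ℕ) :
    qPoch a q (m + n) = qPoch a q m * qPoch (a * q ^ m) q n := by
  simp only [qPoch, prod_range_add]
  congr 1
  exact prod_congr rfl fun j _ => by ring

theorem qPoch_succ' (a q : ℂ) (n : ℕ) :
    qPoch a q (n + 1) = (1 - a) * qPoch (a * q) q n := by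
  rw [add_comm, qPoch_add]
  simp [qPoch]

theorem norm_mul_pow_lt_one {a q : ℂ} (ha : ‖a‖ < 1) (hq : ‖q‖ < 1) (n : ℕ) :
    ‖a * q ^ n‖ < 1 := by
  rw [norm_mul, norm_pow]
  exact mul_lt_one_of_nonneg_of_lt_one_left (norm_nonneg _) ha
    (pow_le_one₀ (norm_nonneg _) hq.le)

theorem one_sub_ne_zero_of_norm_lt_one {x : ℂ} (hx : ‖x‖ < 1) : 1 - x ≠ 0 := by
  intro h
  rw [← sub_eq_zero.mp h] at hx
  simp at hx

theorem qPoch_ne_zero {a q : ℂ} (ha : ‖a‖ < 1) (hq : ‖q‖ < 1) (n : ℕ) : qPoch a q n ≠ 0 :=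
  prod_ne_zero_iff.mpr fun j _ => one_sub_ne_zero_of_norm_lt_one (norm_mul_pow_lt_one ha hq j)

theorem qPoch_mul_qPoch_neg (q : ℂ) (n : ℕ) :
    qPoch q q n * qPoch (-q) q n = qPoch (q ^ 2) (q ^ 2) n := by
  simp only [qPoch, ← prod_mul_distrib]
  exact prod_congr rfl fun j _ => by ring

/-- The reciprocal of `(q;q)_n`. -/
noncomputable def iq (q : ℂ) (n : ℕ) : ℂ := (qPoch q q n)⁻¹

theorem iq_zero (q : ℂ) : iq q 0 = 1 := by simp [iq, qPoch_zero]

theorem one_sub_mul_iq_succ {q : ℂ} (hq : ‖q‖ < 1) (n : ℕ) :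
    (1 - q ^ (n + 1)) * iq q (n + 1) = iq q n := by
  have h := qPoch_ne_zero hq hq (n + 1)
  have h' := qPoch_ne_zero hq hq n
  rw [qPoch_succ] at h
  rw [iq, iq, qPoch_succ]
  have h2 := right_ne_zero_of_mul h
  field_simp
  ring

theorem norm_sq_lt_one {q : ℂ} (hq : ‖q‖ < 1) : ‖q ^ 2‖ < 1 := by
  rw [norm_pow]; exact pow_lt_one₀ (norm_nonneg _) hq two_ne_zero

theorem iq_eq_neg_mul_iq_sq {q : ℂ} (hq : ‖q‖ < 1) (n : ℕ) :
    iq q n = qPoch (-q) q n * iq (q ^ 2) n := by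
  have h := qPoch_ne_zero hq hq n
  have h' := qPoch_ne_zero (a := -q) (by simpa using hq) hq n
  rw [iq, iq, ← qPoch_mul_qPoch_neg]
  field_simp

/-! ### `q`-binomial transformations of the inner sums -/

theorem sum_antidiagonal_one_sub_fst {q : ℂ} (hq : ‖q‖ < 1) (N : ℕ) (f : ℕ → ℕ → ℂ) :
    ∑ p ∈ antidiagonal (N + 1), (1 - q ^ p.1) * iq q p.1 * f p.1 p.2 =
      ∑ p ∈ antidiagonal N, iq q p.1 * f (p.1 + 1) p.2 := by
  rw [Nat.sum_antidiagonal_succ]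
  simp [one_sub_mul_iq_succ hq]

theorem sum_antidiagonal_one_sub_snd {q : ℂ} (hq : ‖q‖ < 1) (N : ℕ) (f : ℕ → ℕ → ℂ) :
    ∑ p ∈ antidiagonal (N + 1), (1 - q ^ p.2) * iq q p.2 * f p.1 p.2 =
      ∑ p ∈ antidiagonal N, iq q p.2 * f p.1 (p.2 + 1) := by
  rw [Nat.sum_antidiagonal_succ']
  simp [one_sub_mul_iq_succ hq]

/-- Pascal-type recurrence for `q`-binomial sums. -/
theorem one_sub_mul_sum_antidiagonal {q : ℂ} (hq : ‖q‖ < 1) (N : ℕ) (f : ℕ → ℕ → ℂ) :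
    (1 - q ^ (N + 1)) * ∑ p ∈ antidiagonal (N + 1), iq q p.1 * iq q p.2 * f p.1 p.2 =
      ∑ p ∈ antidiagonal N,
        iq q p.1 * iq q p.2 * (f (p.1 + 1) p.2 + q ^ p.1 * f p.1 (p.2 + 1)) := by
  have h1 := sum_antidiagonal_one_sub_fst hq N fun r s => iq q s * f r s
  have h2 := sum_antidiagonal_one_sub_snd hq N fun r s => q ^ r * iq q r * f r s
  have h3 : ∑ p ∈ antidiagonal N,
        iq q p.1 * iq q p.2 * (f (p.1 + 1) p.2 + q ^ p.1 * f p.1 (p.2 + 1)) =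
      ∑ p ∈ antidiagonal N, iq q p.1 * (iq q p.2 * f (p.1 + 1) p.2) +
      ∑ p ∈ antidiagonal N, iq q p.2 * (q ^ p.1 * iq q p.1 * f p.1 (p.2 + 1)) := by
    rw [← sum_add_distrib]
    exact sum_congr rfl fun p _ => by ring
  rw [h3, ← h1, ← h2, ← sum_add_distrib, mul_sum]
  refine sum_congr rfl fun p hp => ?_
  rw [← mem_antidiagonal.mp hp]
  ring

theorem one_sub_pow_ne_zero {q : ℂ} (hq : ‖q‖ < 1) (n : ℕ) : 1 - q ^ (n + 1) ≠ 0 := by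
  have := norm_mul_pow_lt_one hq hq n
  rw [← pow_succ'] at this
  exact one_sub_ne_zero_of_norm_lt_one this

/-- With `S_N(z, x)` for either side, Pascal's recurrence gives the same relation twice: `(1 -
q^(N+1)) S_{N+1}(z, x) = S_N(zq, xq) + (x + zq) S_N(zq², xq)`. Hence the induction needs `z` and `x`
free. -/
theorem sum_qBinomial_transform {q : ℂ} (hq : ‖q‖ < 1) (N : ℕ) (z x : ℂ) :
    ∑ p ∈ antidiagonal N, iq q p.1 * iq q p.2 *
        (z ^ p.1 * q ^ (p.1 ^ 2) * qPoch (-(x * q ^ p.1)) q p.2) =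
      ∑ p ∈ antidiagonal N, iq q p.1 * iq q p.2 *
        (q ^ (p.1.choose 2) * ∏ j ∈ range p.1, (x + z * q ^ (j + 1))) := by
  induction N generalizing z x with
  | zero => simp [qPoch_zero]
  | succ N ih =>
    apply mul_left_cancel₀ (one_sub_pow_ne_zero hq N)
    rw [one_sub_mul_sum_antidiagonal hq N
        fun r s => z ^ r * q ^ (r ^ 2) * qPoch (-(x * q ^ r)) q s,
      one_sub_mul_sum_antidiagonal hq N
        fun r _ => q ^ (r.choose 2) * ∏ j ∈ range r, (x + z * q ^ (j + 1))]
    have e1 := ih (z * q) (x * q)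
    have e2 := ih (z * q ^ 2) (x * q)
    trans (∑ p ∈ antidiagonal N, iq q p.1 * iq q p.2 *
        ((z * q) ^ p.1 * q ^ (p.1 ^ 2) * qPoch (-(x * q * q ^ p.1)) q p.2)) +
      (x + z * q) * ∑ p ∈ antidiagonal N, iq q p.1 * iq q p.2 *
        ((z * q ^ 2) ^ p.1 * q ^ (p.1 ^ 2) * qPoch (-(x * q * q ^ p.1)) q p.2)
    · rw [mul_sum, ← sum_add_distrib]
      refine sum_congr rfl fun p _ => ?_
      rw [qPoch_succ', show -(x * q ^ (p.1 + 1)) = -(x * q * q ^ p.1) by ring,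
        show -(x * q ^ p.1) * q = -(x * q * q ^ p.1) by ring]
      ring
    · rw [e1, e2, mul_sum, ← sum_add_distrib]
      refine sum_congr rfl fun p _ => ?_
      have h1 : ∏ j ∈ range p.1, (x * q + z * q * q ^ (j + 1)) =
          q ^ p.1 * ∏ j ∈ range p.1, (x + z * q ^ (j + 1)) := by
        rw [← card_range p.1, ← prod_const, card_range, ← prod_mul_distrib]
        exact prod_congr rfl fun j _ => by ring
      have h2 : ∏ j ∈ range p.1, (x * q + z * q ^ 2 * q ^ (j + 1)) =
          q ^ p.1 * ∏ j ∈ range p.1, (x + z * q ^ (j + 1 + 1)) := by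
        rw [← card_range p.1, ← prod_const, card_range, ← prod_mul_distrib]
        exact prod_congr rfl fun j _ => by ring
      rw [h1, h2, prod_range_succ', Nat.choose_succ_succ' p.1 1, Nat.choose_one_right]
      ring

/-- The sum `∑ z^m q^(m^2) / ((q;q)_m (q^2;q^2)_s)` over `m + s = N`. -/
noncomputable def mixedSum (q z : ℂ) (N : ℕ) : ℂ :=
  ∑ p ∈ antidiagonal N, iq q p.1 * iq (q ^ 2) p.2 * (z ^ p.1 * q ^ (p.1 ^ 2))

/-- For `x = z q^(m+s+t)` each factor `x + z q^(j+1)` splits off `z q^(j+1)`; these powers of `q`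
and `q^(m(m-1)/2)` make up `q^(m²)`. -/
theorem prod_range_add_pow (q z : ℂ) (m s t : ℕ) :
    q ^ (m.choose 2) * ∏ j ∈ range m, (z * q ^ (m + s + t) + z * q ^ (j + 1)) =
      z ^ m * q ^ (m ^ 2) * qPoch (-q ^ (s + t)) q m := by
  induction m generalizing s with
  | zero => simp [qPoch_zero]
  | succ m ih =>
    have := ih (s + 1)
    rw [prod_range_succ, Nat.choose_succ_succ' m 1, Nat.choose_one_right,
      show m + 1 + s + t = m + (s + 1) + t by ring, qPoch_succ',
      show (m + 1) ^ 2 = m ^ 2 + (2 * m + 1) by ring, show -q ^ (s + t) * q = -q ^ (s + 1 + t) by ring]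
    linear_combination (q ^ m * (z * q ^ (m + (s + 1) + t) + z * q ^ (m + 1))) * this

theorem iq_mul_qPoch_shift {q : ℂ} (hq : ‖q‖ < 1) (m s : ℕ) :
    iq q s * qPoch (-q ^ (s + 1)) q m = qPoch (-q) q (m + s) * iq (q ^ 2) s := by
  rw [iq_eq_neg_mul_iq_sq hq, add_comm m, qPoch_add, show -q * q ^ s = -q ^ (s + 1) by ring]
  ring

/-- The choice `x = z q^(N+1)` in the transformation makes the product on its right a shifted
factorial, which turns `1/(q;q)_s` into `(-q;q)_N / (q²;q²)_s`. -/
theorem sum_eq_mixedSum {q : ℂ} (hq : ‖q‖ < 1) (N : ℕ) (z : ℂ) :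
    ∑ p ∈ antidiagonal N, iq q p.1 * iq q p.2 *
        (z ^ p.1 * q ^ (p.1 ^ 2) * qPoch (-(z * q ^ (N + p.1 + 1))) q p.2) =
      qPoch (-q) q N * mixedSum q z N := by
  have h := sum_qBinomial_transform hq N z (z * q ^ (N + 1))
  rw [mixedSum, mul_sum]
  convert h using 1
  · refine sum_congr rfl fun p _ => ?_
    rw [show z * q ^ (N + p.1 + 1) = z * q ^ (N + 1) * q ^ p.1 by ring]
  · refine sum_congr rfl fun p hp => ?_
    rw [← mem_antidiagonal.mp hp, prod_range_add_pow q z p.1 p.2 1]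
    linear_combination (-iq q p.1 * z ^ p.1 * q ^ (p.1 ^ 2)) * iq_mul_qPoch_shift hq p.1 p.2

/-- Here `x = z q^N`, one power short of the value in `sum_eq_mixedSum`. The weight compensates: its
correction term carries `1 - q^r`, drops to level `N - 1`, and is evaluated there by
`sum_eq_mixedSum` at `zq`. -/
theorem sum_weighted_eq_mixedSum {q : ℂ} (hq : ‖q‖ < 1) (N : ℕ) (z : ℂ) :
    ∑ p ∈ antidiagonal N, iq q p.1 * iq q p.2 *
        (z ^ p.1 * q ^ (p.1 ^ 2) * (1 - q ^ p.2 + q ^ N) * qPoch (-(z * q ^ (N + p.1))) q p.2) =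
      qPoch (-q) q N * mixedSum q z N := by
  cases N with
  | zero => simp [mixedSum, qPoch_zero, iq_zero]
  | succ P =>
    have h := sum_qBinomial_transform hq (P + 1) z (z * q ^ (P + 1))
    have hA := sum_eq_mixedSum hq P (z * q)
    have h1 := sum_antidiagonal_one_sub_fst hq P
      fun r s => iq q s * (z ^ r * q ^ (r ^ 2) * q ^ s * qPoch (-(z * q ^ (P + 1 + r))) q s)
    have h2 := sum_antidiagonal_one_sub_fst hq P
      fun m s => iq q s * (z ^ m * q ^ (m ^ 2) * q ^ s * qPoch (-q ^ (s + 1)) q (m - 1))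
    have h3 : ∑ p ∈ antidiagonal P, iq q p.1 * (iq q p.2 *
          (z ^ (p.1 + 1) * q ^ ((p.1 + 1) ^ 2) * q ^ p.2 *
            qPoch (-(z * q ^ (P + 1 + (p.1 + 1)))) q p.2)) =
        ∑ p ∈ antidiagonal P, iq q p.1 * (iq q p.2 *
          (z ^ (p.1 + 1) * q ^ ((p.1 + 1) ^ 2) * q ^ p.2 * qPoch (-q ^ (p.2 + 1)) q p.1)) := by
      trans z * q ^ (P + 1) * (qPoch (-q) q P * mixedSum q (z * q) P)
      · rw [← hA, mul_sum]
        refine sum_congr rfl fun p hp => ?_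
        rw [← mem_antidiagonal.mp hp, show -(z * q ^ (p.1 + p.2 + 1 + (p.1 + 1))) =
          -(z * q * q ^ (p.1 + p.2 + p.1 + 1)) by ring]
        ring
      · rw [mixedSum, mul_sum, mul_sum]
        refine sum_congr rfl fun p hp => ?_
        rw [← mem_antidiagonal.mp hp]
        linear_combination (-iq q p.1 * z ^ (p.1 + 1) * q ^ (p.1 ^ 2 + 2 * p.1 + 1 + p.2)) *
          iq_mul_qPoch_shift hq p.1 p.2
    simp only [Nat.add_sub_cancel] at h2
    rw [← h1, ← h2] at h3
    -- Since `r + s = P + 1`, the weight `1 - q^s + q^(P+1)` equals `1 - q^s (1 - q^r)`.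
    have e1 : ∑ p ∈ antidiagonal (P + 1), iq q p.1 * iq q p.2 *
        (z ^ p.1 * q ^ (p.1 ^ 2) * (1 - q ^ p.2 + q ^ (P + 1)) *
          qPoch (-(z * q ^ (P + 1 + p.1))) q p.2) =
        ∑ p ∈ antidiagonal (P + 1), iq q p.1 * iq q p.2 *
          (z ^ p.1 * q ^ (p.1 ^ 2) * qPoch (-(z * q ^ (P + 1) * q ^ p.1)) q p.2) -
        ∑ p ∈ antidiagonal (P + 1), (1 - q ^ p.1) * iq q p.1 * (iq q p.2 *
          (z ^ p.1 * q ^ (p.1 ^ 2) * q ^ p.2 * qPoch (-(z * q ^ (P + 1 + p.1))) q p.2)) := by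
      rw [← sum_sub_distrib]
      refine sum_congr rfl fun p hp => ?_
      rw [← mem_antidiagonal.mp hp, show z * q ^ (p.1 + p.2) * q ^ p.1 =
        z * q ^ (p.1 + p.2 + p.1) by ring]
      ring
    rw [e1, h, h3, mixedSum, mul_sum, ← sum_sub_distrib]
    refine sum_congr rfl fun p hp => ?_
    have h4 := prod_range_add_pow q z p.1 p.2 0
    rw [← mem_antidiagonal.mp hp]
    simp only [add_zero] at h4
    rw [h4]
    have h5 := iq_mul_qPoch_shift hq p.1 p.2
    -- For `p.1 = 0` the truncated `p.1 - 1` does no harm, because the factor `1 - q^0` vanishes.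
    have h6 : qPoch (-q ^ p.2) q p.1 - (1 - q ^ p.1) * (q ^ p.2 * qPoch (-q ^ (p.2 + 1)) q (p.1 - 1)) =
        qPoch (-q ^ (p.2 + 1)) q p.1 := by
      rcases p.1 with _ | m
      · simp [qPoch_zero]
      · rw [qPoch_succ', Nat.add_sub_cancel, qPoch_succ, show -q ^ p.2 * q = -q ^ (p.2 + 1) by ring]
        ring
    linear_combination (iq q p.1 * z ^ p.1 * q ^ (p.1 ^ 2)) * h5 +
      (iq q p.1 * iq q p.2 * z ^ p.1 * q ^ (p.1 ^ 2)) * h6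

/-! ### Two kernels: `q`-Chu–Vandermonde and change of base -/

/-- A finite `q`-Chu–Vandermonde sum. -/
theorem sum_qVandermonde {q : ℂ} (hq : ‖q‖ < 1) (M c : ℕ) :
    ∑ p ∈ antidiagonal M, iq q p.1 * iq q p.2 * (q ^ (p.1 ^ 2 + c * p.1) * iq q (c + p.1)) =
      iq q M * iq q (M + c) := by
  induction M generalizing c with
  | zero => simp [iq_zero]
  | succ M ih =>
    apply mul_left_cancel₀ (one_sub_pow_ne_zero hq M)
    have h1 := sum_antidiagonal_one_sub_snd hq M
      fun r s => iq q r * (q ^ (r ^ 2 + c * r) * iq q (c + r))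
    have h2 := sum_antidiagonal_one_sub_fst hq M
      fun r s => iq q s * (q ^ s * q ^ (r ^ 2 + c * r) * iq q (c + r))
    trans (∑ p ∈ antidiagonal M, iq q p.1 * iq q p.2 * (q ^ (p.1 ^ 2 + c * p.1) * iq q (c + p.1))) +
      q ^ (M + 1 + c) * ∑ p ∈ antidiagonal M,
        iq q p.1 * iq q p.2 * (q ^ (p.1 ^ 2 + (c + 1) * p.1) * iq q (c + 1 + p.1))
    · have h3 : q ^ (M + 1 + c) * ∑ p ∈ antidiagonal M,
          iq q p.1 * iq q p.2 * (q ^ (p.1 ^ 2 + (c + 1) * p.1) * iq q (c + 1 + p.1)) =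
          ∑ p ∈ antidiagonal M, iq q p.1 *
            (iq q p.2 * (q ^ p.2 * q ^ ((p.1 + 1) ^ 2 + c * (p.1 + 1)) * iq q (c + (p.1 + 1)))) := by
        rw [mul_sum]
        refine sum_congr rfl fun p hp => ?_
        rw [← mem_antidiagonal.mp hp, show c + 1 + p.1 = c + (p.1 + 1) by ring]
        ring
      have h4 : ∑ p ∈ antidiagonal M, iq q p.1 * iq q p.2 *
            (q ^ (p.1 ^ 2 + c * p.1) * iq q (c + p.1)) =
          ∑ p ∈ antidiagonal M, iq q p.2 * (iq q p.1 * (q ^ (p.1 ^ 2 + c * p.1) * iq q (c + p.1))) :=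
        sum_congr rfl fun p _ => by ring
      rw [h3, h4, ← h1, ← h2, ← sum_add_distrib, mul_sum]
      refine sum_congr rfl fun p hp => ?_
      rw [← mem_antidiagonal.mp hp]
      ring
    · rw [ih, ih, show M + (c + 1) = M + c + 1 by ring, show M + 1 + c = M + c + 1 by ring]
      linear_combination (-iq q M) * one_sub_mul_iq_succ hq (M + c) -
        iq q (M + c + 1) * one_sub_mul_iq_succ hq M

/-- The kernel of the change of base `q → q^2` for Bailey pairs. -/
theorem sum_change_of_base {q : ℂ} (hq : ‖q‖ < 1) (M c : ℕ) :
    ∑ p ∈ antidiagonal M,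
        iq q p.1 * iq (q ^ 2) p.2 * (q ^ (p.1 ^ 2 + c * p.1) * iq q (c + p.1)) =
      qPoch (-q) q (2 * M + c) * iq (q ^ 2) M * iq (q ^ 2) (M + c) := by
  have hq2 := norm_sq_lt_one hq
  induction M generalizing c with
  | zero => simp [iq_zero, iq_eq_neg_mul_iq_sq hq c]
  | succ M ih =>
    apply mul_left_cancel₀ (one_sub_pow_ne_zero hq2 M)
    have h1 := sum_antidiagonal_one_sub_snd hq2 M
      fun r s => iq q r * (q ^ (r ^ 2 + c * r) * iq q (c + r))
    -- The splitting is `1 - q^(2(r+s)) = (1 - q^(2s)) + q^(2s) (1 + q^r)(1 - q^r)`: the first part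
    -- lowers `s` in base `q²`, the second lowers `r` in base `q`.
    have h2 := sum_antidiagonal_one_sub_fst hq M
      fun r s => iq (q ^ 2) s * ((q ^ 2) ^ s * (1 + q ^ r) * q ^ (r ^ 2 + c * r) * iq q (c + r))
    trans (1 + q ^ (2 * M + c + 1)) * (∑ p ∈ antidiagonal M,
        iq q p.1 * iq (q ^ 2) p.2 * (q ^ (p.1 ^ 2 + c * p.1) * iq q (c + p.1))) +
      q ^ (2 * M + c + 2) * (1 + q ^ c) * ∑ p ∈ antidiagonal M,
        iq q p.1 * iq (q ^ 2) p.2 * (q ^ (p.1 ^ 2 + (c + 1) * p.1) * iq q (c + 1 + p.1))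
    · trans (∑ p ∈ antidiagonal M, iq (q ^ 2) p.2 *
          (iq q p.1 * (q ^ (p.1 ^ 2 + c * p.1) * iq q (c + p.1)))) +
        ∑ p ∈ antidiagonal M, iq q p.1 * (iq (q ^ 2) p.2 * ((q ^ 2) ^ p.2 * (1 + q ^ (p.1 + 1)) *
          q ^ ((p.1 + 1) ^ 2 + c * (p.1 + 1)) * iq q (c + (p.1 + 1))))
      · rw [← h1, ← h2, ← sum_add_distrib, mul_sum]
        refine sum_congr rfl fun p hp => ?_
        rw [← mem_antidiagonal.mp hp]
        ring
      · rw [mul_sum, mul_sum, ← sum_add_distrib, ← sum_add_distrib]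
        refine sum_congr rfl fun p hp => ?_
        rw [← mem_antidiagonal.mp hp, ← one_sub_mul_iq_succ hq (c + p.1),
          show c + 1 + p.1 = c + p.1 + 1 by ring, show c + (p.1 + 1) = c + p.1 + 1 by ring]
        ring
    · have h3 := one_sub_mul_iq_succ hq2 M
      have h4 := one_sub_mul_iq_succ hq2 (M + c)
      rw [ih, ih, show 2 * (M + 1) + c = 2 * M + c + 1 + 1 by ring,
        show 2 * M + (c + 1) = 2 * M + c + 1 by ring,
        show M + (c + 1) = M + c + 1 by ring, show M + 1 + c = M + c + 1 by ring,
        ← h3, ← h4]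
      simp only [qPoch_succ]
      ring

/-! ### The inner sums of the double series -/

/-- The quotient `(-q;q)_{2N+e} / (-q;q)_{N+r+e}` is exactly the shifted factorial in
`sum_eq_mixedSum` for `z = q^e`. -/
theorem sum_antidiagonal_eq_qPoch_div_mixedSum {q : ℂ} (hq : ‖q‖ < 1) (N e : ℕ) :
    ∑ p ∈ antidiagonal N, q ^ (p.1 ^ 2 + e * p.1) /
        (qPoch (-q) q N * qPoch (-q) q (N + p.1 + e) * qPoch q q p.1 * qPoch q q p.2) =
      mixedSum q (q ^ e) N / qPoch (-q) q (2 * N + e) := by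
  have hq' : ‖-q‖ < 1 := by simpa using hq
  have h0 := qPoch_ne_zero hq' hq
  rw [eq_div_iff (h0 _)]
  apply mul_left_cancel₀ (h0 N)
  rw [← sum_eq_mixedSum hq, sum_mul, mul_sum]
  refine sum_congr rfl fun p hp => ?_
  have h1 : qPoch (-q) q (2 * N + e) =
      qPoch (-q) q (N + p.1 + e) * qPoch (-(q ^ e * q ^ (N + p.1 + 1))) q p.2 := by
    rw [show 2 * N + e = (N + p.1 + e) + p.2 by have := mem_antidiagonal.mp hp; omega, qPoch_add]
    congr 2
    ring
  have h2 := h0 N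
  have h3 := h0 (N + p.1 + e)
  have h4 := qPoch_ne_zero hq hq p.1
  have h5 := qPoch_ne_zero hq hq p.2
  rw [h1, iq, iq]
  field_simp
  ring

theorem sum_weighted_antidiagonal_eq_qPoch_div_mixedSum {q : ℂ} (hq : ‖q‖ < 1) (N e : ℕ) :
    ∑ p ∈ antidiagonal N, q ^ (p.1 ^ 2 + (e + 1) * p.1) * (1 - q ^ p.2 + q ^ N) /
        (qPoch (-q) q N * qPoch (-q) q (N + p.1 + e) * qPoch q q p.1 * qPoch q q p.2) =
      mixedSum q (q ^ (e + 1)) N / qPoch (-q) q (2 * N + e) := by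
  have hq' : ‖-q‖ < 1 := by simpa using hq
  have h0 := qPoch_ne_zero hq' hq
  rw [eq_div_iff (h0 _)]
  apply mul_left_cancel₀ (h0 N)
  rw [← sum_weighted_eq_mixedSum hq, sum_mul, mul_sum]
  refine sum_congr rfl fun p hp => ?_
  have h1 : qPoch (-q) q (2 * N + e) =
      qPoch (-q) q (N + p.1 + e) * qPoch (-(q ^ (e + 1) * q ^ (N + p.1))) q p.2 := by
    rw [show 2 * N + e = (N + p.1 + e) + p.2 by have := mem_antidiagonal.mp hp; omega, qPoch_add]
    congr 2
    ring
  have h2 := h0 N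
  have h3 := h0 (N + p.1 + e)
  have h4 := qPoch_ne_zero hq hq p.1
  have h5 := qPoch_ne_zero hq hq p.2
  rw [h1, iq, iq]
  field_simp
  ring

/-! ### Bilateral sums with finite support -/

/-- `1 / (q;q)_n`, extended by zero to negative `n`. -/
noncomputable def rq (q : ℂ) (n : ℤ) : ℂ := if n < 0 then 0 else iq q n.toNat

theorem rq_of_neg (q : ℂ) {n : ℤ} (hn : n < 0) : rq q n = 0 := if_pos hn

theorem rq_natCast (q : ℂ) (n : ℕ) : rq q n = iq q n := by simp [rq]

theorem one_sub_mul_rq {q : ℂ} (hq : ‖q‖ < 1) (n : ℤ) :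
    (1 - q ^ n) * rq q n = rq q (n - 1) := by
  rcases lt_or_ge n 0 with h | h
  · rw [rq_of_neg q h, rq_of_neg q (by omega), mul_zero]
  · obtain ⟨m, rfl⟩ := Int.eq_ofNat_of_zero_le h
    rcases m with _ | m
    · simp [rq]
    · rw [rq_natCast, show ((m + 1 : ℕ) : ℤ) - 1 = (m : ℕ) by push_cast; ring, rq_natCast,
        zpow_natCast, one_sub_mul_iq_succ hq]

/-- The triangular number `k (k - 1) / 2`. -/
def tri (k : ℤ) : ℤ := k * (k - 1) / 2

theorem two_mul_tri (k : ℤ) : 2 * tri k = k * (k - 1) := by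
  rw [tri, Int.mul_ediv_cancel']
  rw [← even_iff_two_dvd, mul_comm]
  simpa using Int.even_mul_succ_self (k - 1)

theorem tri_add_one (k : ℤ) : tri (k + 1) = tri k + k := by
  linarith [two_mul_tri k, two_mul_tri (k + 1)]

theorem tri_neg (k : ℤ) : tri (-k) = tri k + k := by
  linarith [two_mul_tri k, two_mul_tri (-k)]

/-- The bilateral sum `∑ f(k) / ((p;p)_{a-k} (p;p)_{b+k})`. -/
noncomputable def bilSum (p : ℂ) (a b : ℤ) (f : ℤ → ℂ) : ℂ :=
  ∑' k : ℤ, f k * (rq p (a - k) * rq p (b + k))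

theorem summable_bilSum (p : ℂ) (a b : ℤ) (f : ℤ → ℂ) :
    Summable fun k : ℤ => f k * (rq p (a - k) * rq p (b + k)) := by
  refine summable_of_hasFiniteSupport ((Set.finite_Icc (-b) a).subset fun k hk => ?_)
  by_contra h
  rw [Set.mem_Icc, not_and_or] at h
  apply hk
  rcases h with h | h
  · simp [rq_of_neg p (show b + k < 0 by omega)]
  · simp [rq_of_neg p (show a - k < 0 by omega)]

theorem bilSum_add (p : ℂ) (a b : ℤ) (f g : ℤ → ℂ) :
    bilSum p a b (fun k => f k + g k) = bilSum p a b f + bilSum p a b g := by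
  rw [bilSum, bilSum, bilSum, ← (summable_bilSum p a b f).tsum_add (summable_bilSum p a b g)]
  exact tsum_congr fun k => by ring

theorem bilSum_const_mul (p : ℂ) (a b : ℤ) (c : ℂ) (f : ℤ → ℂ) :
    bilSum p a b (fun k => c * f k) = c * bilSum p a b f := by
  rw [bilSum, bilSum, ← tsum_mul_left]
  exact tsum_congr fun k => by ring

theorem bilSum_left {p : ℂ} (hp : ‖p‖ < 1) (a b : ℤ) (f : ℤ → ℂ) :
    bilSum p a b (fun k => (1 - p ^ (a - k)) * f k) = bilSum p (a - 1) b f := by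
  refine tsum_congr fun k => ?_
  rw [show a - 1 - k = a - k - 1 by ring, ← one_sub_mul_rq hp]
  ring

theorem bilSum_right {p : ℂ} (hp : ‖p‖ < 1) (a b : ℤ) (f : ℤ → ℂ) :
    bilSum p a b (fun k => (1 - p ^ (b + k)) * f k) = bilSum p a (b - 1) f := by
  refine tsum_congr fun k => ?_
  rw [show b - 1 + k = b + k - 1 by ring, ← one_sub_mul_rq hp]
  ring

theorem bilSum_shift (p : ℂ) (a b : ℤ) (f : ℤ → ℂ) :
    bilSum p a b f = bilSum p (a - 1) (b + 1) fun k => f (k + 1) := by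
  rw [bilSum, ← (Equiv.addRight (1 : ℤ)).tsum_eq]
  refine tsum_congr fun k => ?_
  simp only [Equiv.coe_addRight]
  rw [show a - (k + 1) = a - 1 - k by ring, show b + (k + 1) = b + 1 + k by ring]

theorem bilSum_neg (p : ℂ) (a b : ℤ) (f : ℤ → ℂ) :
    bilSum p a b f = bilSum p b a fun k => f (-k) := by
  rw [bilSum, ← (Equiv.neg ℤ).tsum_eq]
  refine tsum_congr fun k => ?_
  simp only [Equiv.neg_apply, sub_neg_eq_add, ← sub_eq_add_neg]
  ring

theorem bilSum_zero_zero (p : ℂ) (f : ℤ → ℂ) : bilSum p 0 0 f = f 0 := by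
  rw [bilSum, tsum_eq_single 0]
  · simp [rq, iq_zero]
  · intro k hk
    rcases lt_or_gt_of_ne hk with h | h
    · rw [rq_of_neg p (show 0 + k < 0 by omega), mul_zero, mul_zero]
    · rw [rq_of_neg p (show 0 - k < 0 by omega), zero_mul, mul_zero]

/-! ### Bailey pairs with cubic theta exponent -/

/-- The general term `(-1)^k q^(A k(k-1)/2 + b k)` of a theta series. -/
noncomputable def thetaTerm (q : ℂ) (A b k : ℤ) : ℂ := (-1) ^ k * q ^ (A * tri k + b * k)

theorem thetaTerm_zero (q : ℂ) (A b : ℤ) : thetaTerm q A b 0 = 1 := by simp [thetaTerm, tri]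

theorem zpow_mul_thetaTerm {q : ℂ} (h0 : q ≠ 0) (A b k n A' b' : ℤ)
    (h : n + (A * tri k + b * k) = A' * tri k + b' * k) :
    q ^ n * thetaTerm q A b k = thetaTerm q A' b' k := by
  rw [thetaTerm, thetaTerm, ← h, zpow_add₀ h0 n]
  ring

/-- Split `1 = (1 - q^(a-k)) + q^(a-k)`: the first part lowers `a`, the second changes the linear
exponent. -/
theorem bilSum_thetaTerm_left {q : ℂ} (h0 : q ≠ 0) (hq : ‖q‖ < 1) (a b A e : ℤ) :
    bilSum q a b (thetaTerm q A e) =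
      bilSum q (a - 1) b (thetaTerm q A e) + q ^ a * bilSum q a b (thetaTerm q A (e - 1)) := by
  rw [← bilSum_left hq, ← bilSum_const_mul, ← bilSum_add]
  congr 1
  funext k
  rw [← zpow_mul_thetaTerm h0 A e k (-k) A (e - 1) (by ring), zpow_sub₀ h0, zpow_neg]
  ring

theorem bilSum_thetaTerm_right {q : ℂ} (h0 : q ≠ 0) (hq : ‖q‖ < 1) (a b A e : ℤ) :
    bilSum q a b (thetaTerm q A e) =
      bilSum q a (b - 1) (thetaTerm q A e) + q ^ b * bilSum q a b (thetaTerm q A (e + 1)) := by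
  rw [← bilSum_right hq, ← bilSum_const_mul, ← bilSum_add]
  congr 1
  funext k
  rw [← zpow_mul_thetaTerm h0 A e k k A (e + 1) (by ring), zpow_add₀ h0]
  ring

theorem thetaTerm_neg (q : ℂ) (A b k : ℤ) : thetaTerm q A b (-k) = thetaTerm q A (A - b) k := by
  rw [thetaTerm, thetaTerm, tri_neg, zpow_neg, ← inv_zpow]
  congr 2
  · norm_num
  · ring

theorem bilSum_thetaTerm_symm (q : ℂ) (m A b : ℤ) :
    bilSum q m m (thetaTerm q A b) = bilSum q m m (thetaTerm q A (A - b)) := by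
  rw [bilSum_neg]
  simp only [thetaTerm_neg]

/-- The reflection `k ↦ -k - 1` preserves the denominators and the power of `q` but reverses the
sign, so the sum is its own negative. -/
theorem bilSum_thetaTerm_self_eq_zero (q : ℂ) (m A : ℤ) :
    bilSum q m (m + 1) (thetaTerm q A A) = 0 := by
  have h : bilSum q m (m + 1) (thetaTerm q A A) = -1 * bilSum q m (m + 1) (thetaTerm q A A) := by
    conv_lhs => rw [bilSum_neg, bilSum_shift]
    rw [← bilSum_const_mul, show m + 1 - 1 = m by ring]
    congr 1
    funext k
    rw [thetaTerm_neg, thetaTerm, thetaTerm, tri_add_one, zpow_add₀ (by norm_num)]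
    rw [show A * (tri k + k) + (A - A) * (k + 1) = A * tri k + A * k by ring]
    ring
  linear_combination h / 2

/-- Write `B_m` and `T_m` for the two sums. Lowering the right index gives `T_m = B_m`, the other
term vanishing by antisymmetry. Lowering the left index leaves exponent 1, which `k ↦ -k` takes back
to 2, so `(1 - q^(m+1)) B_{m+1} = T_m = B_m`. -/
theorem bilSum_three_two {q : ℂ} (h0 : q ≠ 0) (hq : ‖q‖ < 1) (m : ℕ) :
    bilSum q m m (thetaTerm q 3 2) = iq q m ∧ bilSum q m (m + 1) (thetaTerm q 3 2) = iq q m := by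
  have hT : ∀ m : ℕ, bilSum q m (m + 1) (thetaTerm q 3 2) = bilSum q m m (thetaTerm q 3 2) := by
    intro m
    rw [bilSum_thetaTerm_right h0 hq, show (2 : ℤ) + 1 = 3 by norm_num,
      bilSum_thetaTerm_self_eq_zero, mul_zero, add_zero, add_sub_cancel_right]
  rw [hT, and_self]
  induction m with
  | zero => simp [bilSum_zero_zero, thetaTerm_zero, iq_zero]
  | succ m ih =>
    apply mul_left_cancel₀ (one_sub_pow_ne_zero hq m)
    rw [one_sub_mul_iq_succ hq]
    have hm := hT m
    have h1 := bilSum_thetaTerm_left h0 hq (m + 1 : ℕ) (m + 1 : ℕ) 3 2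
    rw [show (2 : ℤ) - 1 = 3 - 2 by norm_num, ← bilSum_thetaTerm_symm q _ 3 2, zpow_natCast] at h1
    push_cast at h1 ⊢
    rw [add_sub_cancel_right] at h1
    linear_combination h1 + hm + ih

theorem bilSum_three_three {q : ℂ} (h0 : q ≠ 0) (hq : ‖q‖ < 1) (m : ℕ) :
    bilSum q m m (thetaTerm q 3 3) = q ^ m * iq q m := by
  have h := bilSum_thetaTerm_self_eq_zero q (m - 1) 3
  rw [sub_add_cancel] at h
  rw [bilSum_thetaTerm_left h0 hq, h, zero_add, zpow_natCast, show (3 : ℤ) - 1 = 2 by norm_num,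
    (bilSum_three_two h0 hq m).1]

theorem bilSum_three_one {q : ℂ} (h0 : q ≠ 0) (hq : ‖q‖ < 1) (m : ℕ) :
    bilSum q m (m + 1) (thetaTerm q 3 1) = (1 + q ^ (m + 1)) * iq q m := by
  rw [bilSum_thetaTerm_right h0 hq, show (1 : ℤ) + 1 = 2 by norm_num,
    (bilSum_three_two h0 hq m).2, add_sub_cancel_right, bilSum_thetaTerm_symm,
    show (3 : ℤ) - 1 = 2 by norm_num, (bilSum_three_two h0 hq m).1]
  rw [show ((m : ℤ) + 1) = ((m + 1 : ℕ) : ℤ) by push_cast; ring, zpow_natCast]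
  ring

/-! ### Change of base for bilateral sums -/

theorem sum_antidiagonal_add_of_eq_zero (f : ℕ → ℕ → ℂ) (j M : ℕ)
    (h : ∀ r s, r < j → f r s = 0) :
    ∑ p ∈ antidiagonal (M + j), f p.1 p.2 = ∑ p ∈ antidiagonal M, f (p.1 + j) p.2 := by
  induction j generalizing f with
  | zero => rfl
  | succ j ih =>
    rw [← add_assoc, Nat.sum_antidiagonal_succ, h 0 _ (by omega), zero_add]
    rw [ih (fun r s => f (r + 1) s) fun r s hr => h _ _ (by omega)]
    exact sum_congr rfl fun p _ => by rw [add_assoc]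

theorem sum_change_of_base_natCast {q : ℂ} (hq : ‖q‖ < 1) (N c k : ℕ) :
    ∑ p ∈ antidiagonal N, q ^ (p.1 ^ 2 + c * p.1) * iq (q ^ 2) p.2 *
        (rq q (p.1 - k) * rq q (p.1 + c + k)) =
      qPoch (-q) q (2 * N + c) *
        (q ^ (k ^ 2 + c * k) * (rq (q ^ 2) (N - k) * rq (q ^ 2) (N + c + k))) := by
  rcases lt_or_ge N k with h | h
  · rw [rq_of_neg (q ^ 2) (by omega), sum_eq_zero]
    · ring
    · intro p hp
      have := mem_antidiagonal.mp hp
      rw [rq_of_neg q (by omega)]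
      ring
  · obtain ⟨M, rfl⟩ := Nat.exists_eq_add_of_le' h
    rw [sum_antidiagonal_add_of_eq_zero (fun r s => q ^ (r ^ 2 + c * r) * iq (q ^ 2) s *
        (rq q (r - k) * rq q (r + c + k))) k M fun r s hr => by
          simp [rq_of_neg q (show (r : ℤ) - k < 0 by omega)]]
    have h1 := sum_change_of_base hq M (2 * k + c)
    have e : ∀ r : ℕ, ((r + k : ℕ) : ℤ) - k = r ∧
        ((r + k : ℕ) : ℤ) + c + k = (r + (2 * k + c) : ℕ) := fun r => by
      push_cast; constructor <;> ring
    simp only [e, rq_natCast]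
    rw [show 2 * (M + k) + c = 2 * M + (2 * k + c) by ring]
    trans q ^ (k ^ 2 + c * k) * (qPoch (-q) q (2 * M + (2 * k + c)) * iq (q ^ 2) M *
      iq (q ^ 2) (M + (2 * k + c)))
    · rw [← h1, mul_sum]
      refine sum_congr rfl fun p _ => ?_
      rw [add_comm (2 * k + c) p.1]
      ring
    · ring

/-- The reflection `k ↦ -c - k` swaps the two reciprocal factors and fixes `k² + ck`. As `c ≤ 1`, it
sends every negative `k` to a nonnegative integer. -/
theorem sum_change_of_base_int {q : ℂ} (hq : ‖q‖ < 1) (N : ℕ) {c : ℕ} (hc : c ≤ 1) (k : ℤ) :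
    ∑ p ∈ antidiagonal N, q ^ (p.1 ^ 2 + c * p.1) * iq (q ^ 2) p.2 *
        (rq q (p.1 - k) * rq q (p.1 + c + k)) =
      qPoch (-q) q (2 * N + c) *
        (q ^ (k ^ 2 + c * k) * (rq (q ^ 2) (N - k) * rq (q ^ 2) (N + c + k))) := by
  rcases le_or_gt 0 k with h | h
  · obtain ⟨j, rfl⟩ := Int.eq_ofNat_of_zero_le h
    rw [sum_change_of_base_natCast hq]
    norm_cast
  · obtain ⟨j, hj⟩ := Int.eq_ofNat_of_zero_le (show 0 ≤ -c - k by omega)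
    obtain rfl : k = -c - j := by omega
    have h1 := sum_change_of_base_natCast hq N c j
    have e : ∀ n : ℕ, (n : ℤ) - (-c - j) = n + c + j ∧ (n : ℤ) + c + (-c - j) = n - j :=
      fun n => by constructor <;> ring
    simp only [e]
    rw [show (-c - j : ℤ) ^ 2 + c * (-c - j) = ((j ^ 2 + c * j : ℕ) : ℤ) by push_cast; ring,
      zpow_natCast, mul_comm (rq (q ^ 2) _), ← h1]
    exact sum_congr rfl fun p _ => by ring

theorem bilSum_change_of_base {q : ℂ} (hq : ‖q‖ < 1) (N : ℕ) {c : ℕ} (hc : c ≤ 1) (f : ℤ → ℂ) :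
    qPoch (-q) q (2 * N + c) * bilSum (q ^ 2) N (N + c) (fun k => q ^ (k ^ 2 + c * k) * f k) =
      ∑ p ∈ antidiagonal N, q ^ (p.1 ^ 2 + c * p.1) * iq (q ^ 2) p.2 *
        bilSum q p.1 (p.1 + c) f := by
  simp only [bilSum, ← tsum_mul_left]
  rw [← Summable.tsum_finsetSum fun p _ => (summable_bilSum q _ _ f).mul_left _]
  refine tsum_congr fun k => ?_
  trans f k * ∑ p ∈ antidiagonal N, q ^ (p.1 ^ 2 + c * p.1) * iq (q ^ 2) p.2 *
        (rq q (p.1 - k) * rq q (p.1 + c + k))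
  · rw [sum_change_of_base_int hq N hc]
    ring
  · rw [mul_sum]
    exact sum_congr rfl fun p _ => by ring

/-- Since `k² + ck = 2 · k(k-1)/2 + (1 + c)k`, the change of base raises the quadratic coefficient
from 3 to 5 and the linear one by `1 + c`. -/
theorem bilSum_five {q : ℂ} (h0 : q ≠ 0) (hq : ‖q‖ < 1) (N : ℕ) {c : ℕ} (hc : c ≤ 1) (b : ℤ) :
    qPoch (-q) q (2 * N + c) * bilSum (q ^ 2) N (N + c) (thetaTerm q 5 (b + 1 + c)) =
      ∑ p ∈ antidiagonal N, q ^ (p.1 ^ 2 + c * p.1) * iq (q ^ 2) p.2 *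
        bilSum q p.1 (p.1 + c) (thetaTerm q 3 b) := by
  rw [← bilSum_change_of_base hq N hc]
  congr 2
  funext k
  rw [zpow_mul_thetaTerm h0 3 b k _ 5 (b + 1 + c)]
  linear_combination -two_mul_tri k

/-! ### Jacobi's triple product, finite and infinite -/

/-- The general term `(-1)^k p^(k(k-1)/2) z^k` of Jacobi's theta series. -/
noncomputable def jacobiTerm (p z : ℂ) (k : ℤ) : ℂ := (-1) ^ k * (p ^ tri k * z ^ k)

/-- Split `1 - p^(a+b) = (1 - p^(a-k)) + p^(a-k) (1 - p^(b+k))`. The second part lowers `b`;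
shifting `k` by one brings it back to the indices `(a - 1, b)` with the factor `-z p^(a-1)`. -/
theorem one_sub_mul_bilSum_jacobiTerm {p z : ℂ} (hp0 : p ≠ 0) (hz : z ≠ 0) (hp : ‖p‖ < 1)
    (a b : ℤ) :
    (1 - p ^ (a + b)) * bilSum p a b (jacobiTerm p z) =
      (1 - z * p ^ (a - 1)) * bilSum p (a - 1) b (jacobiTerm p z) := by
  have h1 := bilSum_left hp a b (jacobiTerm p z)
  have h2 := bilSum_right hp a b fun k => p ^ (a - k) * jacobiTerm p z k
  rw [bilSum_shift p a (b - 1), sub_add_cancel] at h2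
  have h3 : (fun k : ℤ => p ^ (a - (k + 1)) * jacobiTerm p z (k + 1)) =
      fun k : ℤ => (-z * p ^ (a - 1)) * jacobiTerm p z k := by
    funext k
    rw [jacobiTerm, jacobiTerm, tri_add_one, zpow_add₀ hp0 (tri k), zpow_add₀ hz,
      zpow_add₀ (by norm_num : (-1 : ℂ) ≠ 0),
      show a - (k + 1) = (a - 1) - k by ring, zpow_sub₀ hp0 (a - 1)]
    have := zpow_ne_zero k hp0
    field_simp
  rw [h3, bilSum_const_mul] at h2
  rw [← bilSum_const_mul]
  trans bilSum p a b (fun k => (1 - p ^ (a - k)) * jacobiTerm p z k +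
    (1 - p ^ (b + k)) * (p ^ (a - k) * jacobiTerm p z k))
  · congr 1
    funext k
    rw [show a + b = (b + k) + (a - k) by ring, zpow_add₀ hp0 (b + k)]
    ring
  · rw [bilSum_add, h1, h2]
    ring

theorem bilSum_jacobiTerm_symm {p z : ℂ} (hp0 : p ≠ 0) (a b : ℤ) :
    bilSum p a b (jacobiTerm p z) = bilSum p b a (jacobiTerm p (p / z)) := by
  rw [bilSum_neg]
  congr 1
  funext k
  rw [jacobiTerm, jacobiTerm, tri_neg, zpow_add₀ hp0, div_zpow, zpow_neg, ← inv_zpow, zpow_neg,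
    show (-1 : ℂ)⁻¹ = -1 by norm_num]
  ring

/-- The finite form of Jacobi's triple product identity. -/
theorem bilSum_jacobiTerm {p z : ℂ} (hp0 : p ≠ 0) (hz : z ≠ 0) (hp : ‖p‖ < 1) (a b : ℕ) :
    bilSum p a b (jacobiTerm p z) = qPoch z p a * qPoch (p / z) p b * iq p (a + b) := by
  -- The free factor `x` lets this step serve both inductions: on `a`, and on `b` after the symmetry
  -- `z ↦ p / z`.
  have step : ∀ {z : ℂ} (_ : z ≠ 0) (a b : ℕ) (x : ℂ),
      bilSum p a b (jacobiTerm p z) = qPoch z p a * x * iq p (a + b) →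
      bilSum p (a + 1 : ℕ) b (jacobiTerm p z) = qPoch z p (a + 1) * x * iq p (a + 1 + b) := by
    intro z hz a b x h
    apply mul_left_cancel₀ (one_sub_pow_ne_zero hp (a + b))
    have h1 := one_sub_mul_bilSum_jacobiTerm hp0 hz hp (a + 1 : ℕ) b
    rw [show ((a + 1 : ℕ) : ℤ) + b = ((a + b + 1 : ℕ) : ℤ) by push_cast; ring, zpow_natCast,
      show ((a + 1 : ℕ) : ℤ) - 1 = (a : ℕ) by push_cast; ring, zpow_natCast, h] at h1
    rw [h1, qPoch_succ, ← one_sub_mul_iq_succ hp (a + b), show a + 1 + b = a + b + 1 by ring]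
    ring
  induction a with
  | succ a ih => exact step hz a b _ ih
  | zero =>
    have hw : p / z ≠ 0 := div_ne_zero hp0 hz
    rw [bilSum_jacobiTerm_symm hp0, qPoch_zero, one_mul]
    induction b with
    | zero => simp [bilSum_zero_zero, jacobiTerm, tri, qPoch_zero, iq_zero]
    | succ b ih =>
      have := step hw b 0 1 (by simpa using ih)
      simpa using this

theorem tendsto_qPoch (a : ℂ) {q : ℂ} (hq : ‖q‖ < 1) :
    Tendsto (qPoch a q) atTop (𝓝 (qPochInf a q)) :=
  (multipliable_qPochInf a q hq).hasProd.tendsto_prod_nat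

theorem qPochInf_ne_zero {a q : ℂ} (ha : ‖a‖ < 1) (hq : ‖q‖ < 1) : qPochInf a q ≠ 0 := by
  have h := tprod_one_add_ne_zero_of_summable (f := fun j : ℕ => -(a * q ^ j)) (fun j => ?_) ?_
  · simpa [qPochInf, sub_eq_add_neg] using h
  · rw [← sub_eq_add_neg]
    exact one_sub_ne_zero_of_norm_lt_one (norm_mul_pow_lt_one ha hq j)
  · simpa using ((summable_geometric_of_lt_one (norm_nonneg _) hq).mul_left ‖a‖)

theorem exists_norm_inv_qPoch_le {a q : ℂ} (ha : ‖a‖ < 1) (hq : ‖q‖ < 1) :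
    ∃ C, 0 ≤ C ∧ ∀ n, ‖(qPoch a q n)⁻¹‖ ≤ C := by
  obtain ⟨C, hC⟩ := ((tendsto_qPoch a hq).inv₀ (qPochInf_ne_zero ha hq)).norm.bddAbove_range
  have h : ∀ n, ‖(qPoch a q n)⁻¹‖ ≤ C := fun n => hC ⟨n, rfl⟩
  exact ⟨C, (norm_nonneg _).trans (h 0), h⟩

theorem exists_norm_rq_le {q : ℂ} (hq : ‖q‖ < 1) : ∃ C, 0 ≤ C ∧ ∀ n, ‖rq q n‖ ≤ C := by
  obtain ⟨C, h0, hC⟩ := exists_norm_inv_qPoch_le hq hq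
  refine ⟨C, h0, fun n => ?_⟩
  rw [rq]
  split_ifs
  · simpa using h0
  · exact hC _

theorem tendsto_rq {q : ℂ} (hq : ‖q‖ < 1) : Tendsto (rq q) atTop (𝓝 (qPochInf q q)⁻¹) := by
  have h1 : Tendsto (iq q) atTop (𝓝 (qPochInf q q)⁻¹) :=
    (tendsto_qPoch q hq).inv₀ (qPochInf_ne_zero hq hq)
  have h2 : Tendsto Int.toNat atTop atTop :=
    tendsto_atTop.mpr fun n => (eventually_ge_atTop (n : ℤ)).mono fun m hm => by omega
  refine (h1.comp h2).congr' ?_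
  filter_upwards [eventually_ge_atTop 0] with n hn
  simp [rq, hn]

theorem tendsto_bilSum {p : ℂ} (hp : ‖p‖ < 1) {f : ℤ → ℂ} (hf : Summable f) :
    Tendsto (fun m : ℕ => bilSum p m m f) atTop
      (𝓝 ((∑' k, f k) * ((qPochInf p p)⁻¹ * (qPochInf p p)⁻¹))) := by
  obtain ⟨C, h0, hC⟩ := exists_norm_rq_le hp
  rw [← tsum_mul_right]
  refine tendsto_tsum_of_dominated_convergence (bound := fun k => ‖f k‖ * (C * C))
    (hf.norm.mul_right _) (fun k => ?_) (Eventually.of_forall fun m k => ?_)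
  · refine ((tendsto_rq hp).comp ?_ |>.mul ((tendsto_rq hp).comp ?_)).const_mul _
    · simpa only [sub_eq_add_neg] using
        tendsto_atTop_add_const_right _ (-k) tendsto_natCast_atTop_atTop
    · exact tendsto_atTop_add_const_right _ k tendsto_natCast_atTop_atTop
  · rw [norm_mul, norm_mul]
    gcongr <;> exact hC _

/-- Jacobi's triple product identity. -/
theorem tsum_jacobiTerm {p z : ℂ} (hp0 : p ≠ 0) (hz : z ≠ 0) (hp : ‖p‖ < 1)
    (hs : Summable (jacobiTerm p z)) :
    ∑' k, jacobiTerm p z k = qPochInf z p * qPochInf (p / z) p * qPochInf p p := by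
  have h1 := tendsto_bilSum hp hs
  have h2 : Tendsto (fun m : ℕ => bilSum p m m (jacobiTerm p z)) atTop
      (𝓝 (qPochInf z p * qPochInf (p / z) p * (qPochInf p p)⁻¹)) := by
    simp only [bilSum_jacobiTerm hp0 hz hp]
    refine ((tendsto_qPoch z hp).mul (tendsto_qPoch _ hp)).mul ?_
    exact ((tendsto_qPoch p hp).inv₀ (qPochInf_ne_zero hp hp)).comp
      (tendsto_atTop_mono (fun n => Nat.le_add_left n n) tendsto_id)
  have h3 := tendsto_nhds_unique h1 h2
  have h4 := qPochInf_ne_zero hp hp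
  field_simp at h3
  linear_combination h3

/-! ### Convergence and product form of theta series -/

theorem HasSum.of_forall_eq {ι : Type*} {f g : ι → ℂ} {a : ℂ} (hg : HasSum g a)
    (h : ∀ i, f i = g i) : HasSum f a := by
  rwa [show f = g from funext h]

/-- This linear lower bound on the exponent makes the theta series dominated by a geometric one. For
`k < 0` the exponent is `|k|` plus `(A - b - 1) tri k + (b + 1)(tri k + k)`, both terms nonnegative.
-/
theorem le_mul_tri_add {A b : ℤ} (hb : 1 ≤ b) (hA : b + 1 ≤ A) (k : ℤ) :
    |k| ≤ A * tri k + b * k := by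
  have h := two_mul_tri k
  have h' : 0 ≤ tri k := by
    rcases le_or_gt k 0 with hk | hk <;> nlinarith
  have h'' : 0 ≤ tri k + k := by
    rcases le_or_gt 0 k with hk | hk <;> nlinarith
  rcases le_or_gt 0 k with hk | hk
  · rw [abs_of_nonneg hk]
    nlinarith
  · rw [abs_of_neg hk]
    nlinarith [mul_nonneg (sub_nonneg.mpr hA) h', mul_nonneg (by omega : 0 ≤ b + 1) h'']

theorem summable_pow_natAbs {x : ℝ} (h0 : 0 ≤ x) (h1 : x < 1) :
    Summable fun k : ℤ => x ^ k.natAbs := by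
  have := summable_geometric_of_lt_one h0 h1
  exact Summable.of_nat_of_neg (by simpa using this) (by simpa using this)

theorem norm_thetaTerm_le {q : ℂ} (h0 : q ≠ 0) (hq : ‖q‖ < 1) {A b : ℤ} (hb : 1 ≤ b)
    (hA : b + 1 ≤ A) (k : ℤ) : ‖thetaTerm q A b k‖ ≤ ‖q‖ ^ k.natAbs := by
  rw [thetaTerm, norm_mul, norm_zpow, norm_neg, norm_one, one_zpow, one_mul, norm_zpow,
    ← zpow_natCast, Int.natCast_natAbs]
  exact zpow_le_zpow_right_of_le_one₀ (norm_pos_iff.mpr h0) hq.le (le_mul_tri_add hb hA k)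

theorem summable_norm_thetaTerm {q : ℂ} (h0 : q ≠ 0) (hq : ‖q‖ < 1) {A b : ℤ} (hb : 1 ≤ b)
    (hA : b + 1 ≤ A) : Summable fun k => ‖thetaTerm q A b k‖ :=
  (summable_pow_natAbs (norm_nonneg q) hq).of_nonneg_of_le (fun _ => norm_nonneg _)
    (norm_thetaTerm_le h0 hq hb hA)

theorem tsum_thetaTerm {q : ℂ} (h0 : q ≠ 0) (hq : ‖q‖ < 1) {A b : ℕ} (hb : 1 ≤ b)
    (hA : b + 1 ≤ A) :
    ∑' k, thetaTerm q A b k = qPochInf₃ (q ^ (A - b)) (q ^ b) (q ^ A) (q ^ A) := by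
  have e : thetaTerm q A b = jacobiTerm (q ^ A) (q ^ b) := by
    funext k
    rw [thetaTerm, jacobiTerm, zpow_add₀ h0, zpow_mul, zpow_mul, zpow_natCast, zpow_natCast]
  have hs : Summable (thetaTerm q A b) :=
    (summable_norm_thetaTerm h0 hq (by exact_mod_cast hb) (by exact_mod_cast hA)).of_norm
  have hd : q ^ A / q ^ b = q ^ (A - b) := by rw [pow_sub₀ q h0 (by omega), div_eq_mul_inv]
  rw [e] at hs ⊢
  rw [tsum_jacobiTerm (pow_ne_zero _ h0) (pow_ne_zero _ h0) _ hs, qPochInf₃, hd]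
  · ring
  · rw [norm_pow]
    exact pow_lt_one₀ (norm_nonneg _) hq (by omega)

/-! ### Durfee rectangles and the sum over `N` -/

/-- The Durfee rectangle identity. -/
theorem hasSum_durfee {q : ℂ} (hq : ‖q‖ < 1) (c : ℕ) :
    HasSum (fun t : ℕ => q ^ (t ^ 2 + c * t) * (iq q t * iq q (c + t))) (qPochInf q q)⁻¹ := by
  obtain ⟨C, h0, hC⟩ := exists_norm_rq_le hq
  have hC' : ∀ n, ‖iq q n‖ ≤ C := fun n => by rw [← rq_natCast]; exact hC n
  have hb : ∀ t : ℕ, ‖q ^ (t ^ 2 + c * t) * (iq q t * iq q (c + t))‖ ≤ ‖q‖ ^ t * (C * C) := by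
    intro t
    rw [norm_mul, norm_mul, norm_pow]
    gcongr ?_ * (?_ * ?_)
    · exact pow_le_pow_of_le_one (norm_nonneg _) hq.le
        ((Nat.le_self_pow two_ne_zero t).trans (Nat.le_add_right _ _))
    · exact hC' _
    · exact hC' _
  have hg := summable_geometric_of_lt_one (norm_nonneg q) hq
  have hs : Summable fun t : ℕ => q ^ (t ^ 2 + c * t) * (iq q t * iq q (c + t)) :=
    Summable.of_norm_bounded (hg.mul_right _) hb
  -- Let `M → ∞` in `sum_qVandermonde`. Both limits contain `1/(q;q)_∞`, and cancelling it leaves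
  -- the identity.
  have h1 : Tendsto (fun M : ℕ => ∑' t : ℕ,
      q ^ (t ^ 2 + c * t) * (iq q t * iq q (c + t)) * rq q (M - t)) atTop
      (𝓝 ((∑' t : ℕ, q ^ (t ^ 2 + c * t) * (iq q t * iq q (c + t))) * (qPochInf q q)⁻¹)) := by
    rw [← tsum_mul_right]
    refine tendsto_tsum_of_dominated_convergence (bound := fun t => ‖q‖ ^ t * (C * C) * C)
      ((hg.mul_right _).mul_right _) (fun t => ?_) (Eventually.of_forall fun M t => ?_)
    · refine ((tendsto_rq hq).comp ?_).const_mul _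
      simpa only [sub_eq_add_neg] using
        tendsto_atTop_add_const_right _ (-(t : ℤ)) tendsto_natCast_atTop_atTop
    · rw [norm_mul]
      exact mul_le_mul (hb t) (hC _) (norm_nonneg _) (by positivity)
  have h2 : ∀ M : ℕ, ∑' t : ℕ, q ^ (t ^ 2 + c * t) * (iq q t * iq q (c + t)) * rq q (M - t) =
      iq q M * iq q (M + c) := by
    intro M
    rw [← sum_qVandermonde hq, Finset.Nat.sum_antidiagonal_eq_sum_range_succ
      (fun r s => iq q r * iq q s * (q ^ (r ^ 2 + c * r) * iq q (c + r))) M]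
    rw [tsum_eq_sum (s := range (M + 1))]
    · refine sum_congr rfl fun t ht => ?_
      rw [← Nat.cast_sub (by have := mem_range.mp ht; omega), rq_natCast]
      ring
    · intro t ht
      rw [rq_of_neg q (by have := mem_range.not.mp ht; omega), mul_zero]
  have hiq : Tendsto (iq q) atTop (𝓝 (qPochInf q q)⁻¹) :=
    (tendsto_qPoch q hq).inv₀ (qPochInf_ne_zero hq hq)
  have h3 : Tendsto (fun M : ℕ => iq q M * iq q (M + c)) atTop
      (𝓝 ((qPochInf q q)⁻¹ * (qPochInf q q)⁻¹)) :=
    hiq.mul (hiq.comp (tendsto_add_atTop_nat c))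
  simp only [h2] at h1
  have h4 := mul_right_cancel₀ (inv_ne_zero (qPochInf_ne_zero hq hq)) (tendsto_nhds_unique h1 h3)
  rw [← h4]
  exact hs.hasSum

theorem hasSum_durfee_shift {q : ℂ} (hq : ‖q‖ < 1) (c k : ℕ) :
    HasSum (fun N : ℕ => q ^ (N ^ 2 + c * N) * (rq q (N - k) * rq q (N + c + k)))
      (q ^ (k ^ 2 + c * k) * (qPochInf q q)⁻¹) := by
  rw [← (add_left_injective k).hasSum_iff]
  · refine ((hasSum_durfee hq (2 * k + c)).mul_left (q ^ (k ^ 2 + c * k))).of_forall_eq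
      fun t => ?_
    simp only [Function.comp]
    rw [show ((t + k : ℕ) : ℤ) - k = t by push_cast; ring,
      show ((t + k : ℕ) : ℤ) + c + k = (2 * k + c + t : ℕ) by push_cast; ring,
      rq_natCast, rq_natCast]
    ring
  · intro N hN
    have : N < k := by
      by_contra h
      exact hN ⟨N - k, by simp; omega⟩
    rw [rq_of_neg q (by omega)]
    ring

theorem hasSum_durfee_int {q : ℂ} (hq : ‖q‖ < 1) {c : ℕ} (hc : c ≤ 1) (k : ℤ) :
    HasSum (fun N : ℕ => q ^ (N ^ 2 + c * N) * (rq q (N - k) * rq q (N + c + k)))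
      (q ^ (k ^ 2 + c * k) * (qPochInf q q)⁻¹) := by
  rcases le_or_gt 0 k with h | h
  · obtain ⟨j, rfl⟩ := Int.eq_ofNat_of_zero_le h
    convert hasSum_durfee_shift hq c j using 2
    norm_cast
  · obtain ⟨j, hj⟩ := Int.eq_ofNat_of_zero_le (show 0 ≤ -c - k by omega)
    obtain rfl : k = -c - j := by omega
    rw [show (-c - j : ℤ) ^ 2 + c * (-c - j) = ((j ^ 2 + c * j : ℕ) : ℤ) by push_cast; ring,
      zpow_natCast]
    convert hasSum_durfee_shift hq c j using 1
    funext n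
    rw [show (n : ℤ) - (-c - j) = n + c + j by ring, show (n : ℤ) + c + (-c - j) = n - j by ring]
    ring

theorem summable_bilSum_prod {q : ℂ} (h0 : q ≠ 0) (hq : ‖q‖ < 1) (c : ℕ) {A b : ℤ} (hb : 1 ≤ b)
    (hA : b + 1 ≤ A) :
    Summable fun x : ℕ × ℤ => (q ^ 2) ^ (x.1 ^ 2 + c * x.1) *
      (thetaTerm q A b x.2 * (rq (q ^ 2) (x.1 - x.2) * rq (q ^ 2) (x.1 + c + x.2))) := by
  have hq2 := norm_sq_lt_one hq
  obtain ⟨C, hC0, hC⟩ := exists_norm_rq_le hq2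
  have h1 := summable_geometric_of_lt_one (norm_nonneg _) hq2
  have h2 := summable_norm_thetaTerm h0 hq hb hA
  refine Summable.of_norm_bounded (g := fun x : ℕ × ℤ =>
    ‖q ^ 2‖ ^ x.1 * ‖thetaTerm q A b x.2‖ * (C * C)) ?_ fun x => ?_
  · refine Summable.mul_right _ ?_
    exact h1.mul_of_nonneg h2 (fun n => pow_nonneg (norm_nonneg _) n) fun _ => norm_nonneg _
  · rw [norm_mul, norm_mul, norm_mul, norm_pow (q ^ 2), mul_assoc (_ ^ x.1)]
    refine mul_le_mul ?_ (mul_le_mul_of_nonneg_left ?_ (norm_nonneg _)) (by positivity)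
      (by positivity)
    · exact pow_le_pow_of_le_one (norm_nonneg _) hq2.le
        ((Nat.le_self_pow two_ne_zero x.1).trans (Nat.le_add_right _ _))
    · exact mul_le_mul (hC _) (hC _) (norm_nonneg _) hC0

/-- The double family over `(N, k)` is absolutely summable. Summing over `k` first gives the left
side; summing over `N` first applies the Durfee identity in base `q²` and leaves a theta series with
coefficient 9. -/
theorem hasSum_bilSum {q : ℂ} (h0 : q ≠ 0) (hq : ‖q‖ < 1) {c b : ℕ} (hc : c ≤ 1) (hb : 1 ≤ b)
    (hb' : b ≤ 4) :
    HasSum (fun N : ℕ => (q ^ 2) ^ (N ^ 2 + c * N) *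
        bilSum (q ^ 2) N (N + c) (thetaTerm q 5 b))
      (qPochInf₃ (q ^ (7 - b - 2 * c)) (q ^ (b + 2 + 2 * c)) (q ^ 9) (q ^ 9) /
        qPochInf (q ^ 2) (q ^ 2)) := by
  have hq2 := norm_sq_lt_one hq
  obtain ⟨S, hS⟩ := summable_bilSum_prod h0 hq c (A := 5) (b := b) (by omega) (by omega)
  have e1 : HasSum (fun N : ℕ => (q ^ 2) ^ (N ^ 2 + c * N) *
      bilSum (q ^ 2) N (N + c) (thetaTerm q 5 b)) S := by
    refine hS.prod_fiberwise fun N => ?_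
    exact HasSum.mul_left ((q ^ 2) ^ (N ^ 2 + c * N))
      (summable_bilSum (q ^ 2) N (N + c) (thetaTerm q 5 b)).hasSum
  have e2 : HasSum (fun k : ℤ => thetaTerm q 9 (b + 2 + 2 * c : ℕ) k * (qPochInf (q ^ 2) (q ^ 2))⁻¹)
      S := by
    refine ((Equiv.prodComm ℤ ℕ).hasSum_iff.mpr hS).prod_fiberwise fun k => ?_
    have e : (q ^ 2) ^ (k ^ 2 + c * k) * thetaTerm q 5 b k =
        thetaTerm q 9 (b + 2 + 2 * c : ℕ) k := by
      rw [← zpow_mul_thetaTerm h0 5 b k (2 * (k ^ 2 + c * k)) 9 (b + 2 + 2 * c : ℕ)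
        (by push_cast; linear_combination (-2) * two_mul_tri k), zpow_mul]
      norm_cast
    rw [← e, mul_right_comm, mul_comm _ (thetaTerm q 5 b k)]
    refine ((hasSum_durfee_int hq2 hc k).mul_left (thetaTerm q 5 b k)).of_forall_eq fun N => ?_
    simp only [Function.comp, Equiv.prodComm_apply, Prod.swap]
    ring
  have e3 := e2.tsum_eq
  have e4 := tsum_thetaTerm h0 hq (A := 9) (b := b + 2 + 2 * c) (by omega) (by omega)
  rw [Nat.cast_ofNat] at e4
  rw [tsum_mul_right, e4] at e3
  rw [← e3, show 9 - (b + 2 + 2 * c) = 7 - b - 2 * c by omega] at e1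
  exact e1

/-! ### The inner sums as bilateral sums in base `q²` -/

theorem mixedSum_eq_bilSum {q : ℂ} (h0 : q ≠ 0) (hq : ‖q‖ < 1) (N : ℕ) {c : ℕ} (hc : c ≤ 1) :
    mixedSum q (q ^ c) N / qPoch (-q) q (2 * N + c) =
      bilSum (q ^ 2) N (N + c) (thetaTerm q 5 (3 + c : ℕ)) := by
  rw [div_eq_iff (qPoch_ne_zero (by simpa using hq) hq _), mul_comm, mixedSum]
  have h := bilSum_five h0 hq N hc 2
  rw [show (2 : ℤ) + 1 + c = (3 + c : ℕ) by push_cast; ring] at h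
  rw [h]
  refine sum_congr rfl fun p _ => ?_
  have h1 : bilSum q p.1 (p.1 + c) (thetaTerm q 3 2) = iq q p.1 := by
    interval_cases c
    · simpa using (bilSum_three_two h0 hq p.1).1
    · simpa using (bilSum_three_two h0 hq p.1).2
  rw [h1]
  ring

theorem mixedSum_self_eq_bilSum {q : ℂ} (h0 : q ≠ 0) (hq : ‖q‖ < 1) (N : ℕ) :
    mixedSum q q N / qPoch (-q) q (2 * N) = bilSum (q ^ 2) N N (thetaTerm q 5 4) := by
  rw [div_eq_iff (qPoch_ne_zero (by simpa using hq) hq _), mul_comm, mixedSum]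
  have h := bilSum_five h0 hq N (c := 0) (by norm_num) 3
  norm_num at h
  rw [h]
  refine sum_congr rfl fun p _ => ?_
  rw [bilSum_three_three h0 hq]
  ring

/-- The factor `1 + q^(m+1)` of the pair with linear exponent 1 produces the two summands, with `z =
q` and `z = q²`. -/
theorem mixedSum_add_eq_bilSum {q : ℂ} (h0 : q ≠ 0) (hq : ‖q‖ < 1) (N : ℕ) :
    mixedSum q q N / qPoch (-q) q (2 * N + 1) +
        q * (mixedSum q (q ^ 2) N / qPoch (-q) q (2 * N + 1)) =
      bilSum (q ^ 2) N (N + 1) (thetaTerm q 5 3) := by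
  rw [← mul_div_assoc, ← add_div, div_eq_iff (qPoch_ne_zero (by simpa using hq) hq _),
    mul_comm _ (qPoch _ _ _), mixedSum, mixedSum]
  have h := bilSum_five h0 hq N (c := 1) le_rfl 1
  norm_num at h
  rw [h, mul_sum, ← sum_add_distrib]
  refine sum_congr rfl fun p _ => ?_
  rw [bilSum_three_one h0 hq]
  ring

/-! ### Assembly of the double series -/

/-- The swap is there because the inner sums list `(r, n)` on the antidiagonal, while the double
series is indexed by `(n, r)`. -/
theorem hasSum_of_antidiagonal {F : ℕ × ℕ → ℂ} (hF : Summable F) {g : ℕ → ℂ} {S : ℂ}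
    (hg : HasSum g S) (h : ∀ N, ∑ p ∈ antidiagonal N, F p.swap = g N) : HasSum F S := by
  obtain ⟨T, hT⟩ := hF
  have h1 := (Finset.HasAntidiagonal.sigmaAntidiagonalEquivProd (A := ℕ)).hasSum_iff.mpr hT
  have h2 := h1.sigma (g := g) fun N => ?_
  · rwa [hg.unique h2]
  · rw [← h, ← Finset.Nat.sum_antidiagonal_swap]
    simpa [Function.comp_def] using Finset.hasSum (antidiagonal N) F

/-- Reciprocal factorials are bounded, so `q^(n+r)` dominates. The bound 4 on `X` counts the
monomials of the longest numerator, each of norm at most 1. -/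
theorem summable_double {q : ℂ} (hq : ‖q‖ < 1) {E a b : ℕ × ℕ → ℕ} {X : ℕ × ℕ → ℂ}
    (hE : ∀ p, p.1 + p.2 ≤ E p) (hX : ∀ p, ‖X p‖ ≤ 4) :
    Summable fun p : ℕ × ℕ => q ^ E p * X p /
      (qPoch (-q) q (a p) * qPoch (-q) q (b p) * qPoch q q p.2 * qPoch q q p.1) := by
  obtain ⟨C, hC0, hC⟩ := exists_norm_inv_qPoch_le (a := -q) (by simpa using hq) hq
  obtain ⟨D, hD0, hD⟩ := exists_norm_inv_qPoch_le hq hq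
  have h1 := summable_geometric_of_lt_one (norm_nonneg _) hq
  refine Summable.of_norm_bounded (g := fun p : ℕ × ℕ =>
    ‖q‖ ^ p.1 * ‖q‖ ^ p.2 * (4 * (C * C * D * D))) ?_ fun p => ?_
  · refine Summable.mul_right _ ?_
    exact h1.mul_of_nonneg h1 (fun n => pow_nonneg (norm_nonneg _) n)
      fun n => pow_nonneg (norm_nonneg _) n
  · rw [div_eq_mul_inv, mul_inv, mul_inv, mul_inv, norm_mul, norm_mul, norm_mul, norm_mul,
      norm_mul, norm_pow, ← pow_add, mul_assoc (_ ^ _)]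
    gcongr ?_ * (?_ * (?_ * ?_ * ?_ * ?_))
    · exact pow_le_pow_of_le_one (norm_nonneg _) hq.le (hE p)
    · exact hX p
    · exact hC _
    · exact hC _
    · exact hD _
    · exact hD _

theorem qPoch_trisect (x : ℂ) (n : ℕ) :
    qPoch x x (3 * n) = qPoch x (x ^ 3) n * qPoch (x ^ 2) (x ^ 3) n * qPoch (x ^ 3) (x ^ 3) n := by
  induction n with
  | zero => simp [qPoch_zero]
  | succ n ih =>
    rw [show 3 * (n + 1) = 3 * n + 1 + 1 + 1 by ring]
    simp only [qPoch_succ]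
    rw [ih]
    ring

theorem qPochInf_trisect {x : ℂ} (hx : ‖x‖ < 1) :
    qPochInf₃ x (x ^ 2) (x ^ 3) (x ^ 3) = qPochInf x x := by
  have hx3 : ‖x ^ 3‖ < 1 := by
    rw [norm_pow]
    exact pow_lt_one₀ (norm_nonneg _) hx three_ne_zero
  have h1 : Tendsto (fun n => qPoch x x (3 * n)) atTop (𝓝 (qPochInf x x)) :=
    (tendsto_qPoch x hx).comp (tendsto_id.const_mul_atTop' three_pos)
  simp only [qPoch_trisect] at h1
  exact tendsto_nhds_unique
    (((tendsto_qPoch x hx3).mul (tendsto_qPoch _ hx3)).mul (tendsto_qPoch _ hx3)) h1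

theorem hasSum_of_eq_zero {F : ℕ × ℕ → ℂ} {S : ℂ} (h : ∀ p, 0 < p.1 + p.2 → F p = 0)
    (hS : F 0 = S) : HasSum F S := by
  rw [← hS]
  refine hasSum_single 0 fun p hp => h p ?_
  by_contra h'
  exact hp (Prod.ext (by simp; omega) (by simp; omega))

theorem add_le_exponent (n r l : ℕ) : n + r ≤ 2 * n ^ 2 + 3 * r ^ 2 + 4 * n * r + l := by
  have h1 := Nat.le_self_pow two_ne_zero n
  have h2 := Nat.le_self_pow two_ne_zero r
  have h3 := Nat.zero_le (4 * n * r)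
  omega

theorem hasSum_mod_nine_one_eight {q : ℂ} (h0 : q ≠ 0) (hq : ‖q‖ < 1) :
    HasSum (fun p : ℕ × ℕ =>
        q ^ (2 * p.1 ^ 2 + 3 * p.2 ^ 2 + 4 * p.1 * p.2 + 2 * p.1 + 3 * p.2) /
          (qPoch (-q) q (p.1 + p.2) * qPoch (-q) q (p.1 + 2 * p.2 + 1) *
            qPoch q q p.2 * qPoch q q p.1))
      (qPochInf₃ q (q ^ 8) (q ^ 9) (q ^ 9) / qPochInf (q ^ 2) (q ^ 2)) := by
  have hS := hasSum_bilSum h0 hq (c := 1) (b := 4) le_rfl (by norm_num) le_rfl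
  norm_num at hS
  refine hasSum_of_antidiagonal ?_ hS fun N => ?_
  · simpa using summable_double hq (X := fun _ => 1)
      (fun p => (add_le_exponent p.1 p.2 (2 * p.1 + 3 * p.2)).trans_eq (add_assoc _ _ _).symm)
      (by norm_num)
  · have h1 := sum_antidiagonal_eq_qPoch_div_mixedSum hq N 1
    rw [mixedSum_eq_bilSum h0 hq N le_rfl] at h1
    norm_num at h1
    rw [← h1, mul_sum]
    refine sum_congr rfl fun p hp => ?_
    obtain rfl := mem_antidiagonal.mp hp
    simp only [Prod.fst_swap, Prod.snd_swap]
    rw [show p.2 + p.1 = p.1 + p.2 by ring, show p.2 + 2 * p.1 = p.1 + p.2 + p.1 by ring]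
    ring

theorem hasSum_mod_nine_four_five {q : ℂ} (h0 : q ≠ 0) (hq : ‖q‖ < 1) :
    HasSum (fun p : ℕ × ℕ =>
        q ^ (2 * p.1 ^ 2 + 3 * p.2 ^ 2 + 4 * p.1 * p.2) /
          (qPoch (-q) q (p.1 + p.2) * qPoch (-q) q (p.1 + 2 * p.2) *
            qPoch q q p.2 * qPoch q q p.1))
      (qPochInf₃ (q ^ 4) (q ^ 5) (q ^ 9) (q ^ 9) / qPochInf (q ^ 2) (q ^ 2)) := by
  have hS := hasSum_bilSum h0 hq (c := 0) (b := 3) zero_le_one (by norm_num) (by norm_num)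
  norm_num at hS
  refine hasSum_of_antidiagonal ?_ hS fun N => ?_
  · simpa using summable_double hq (X := fun _ => 1) (fun p => add_le_exponent p.1 p.2 0)
      (by norm_num)
  · have h1 := sum_antidiagonal_eq_qPoch_div_mixedSum hq N 0
    rw [mixedSum_eq_bilSum h0 hq N zero_le_one] at h1
    norm_num at h1
    rw [← h1, mul_sum]
    refine sum_congr rfl fun p hp => ?_
    obtain rfl := mem_antidiagonal.mp hp
    simp only [Prod.fst_swap, Prod.snd_swap]
    rw [show p.2 + p.1 = p.1 + p.2 by ring, show p.2 + 2 * p.1 = p.1 + p.2 + p.1 by ring]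
    ring

theorem hasSum_mod_nine_three_six {q : ℂ} (h0 : q ≠ 0) (hq : ‖q‖ < 1) :
    HasSum (fun p : ℕ × ℕ =>
        q ^ (2 * p.1 ^ 2 + 3 * p.2 ^ 2 + 4 * p.1 * p.2 + p.2) *
            (1 - q ^ p.1 + q ^ (p.1 + p.2)) /
          (qPoch (-q) q (p.1 + p.2) * qPoch (-q) q (p.1 + 2 * p.2) *
            qPoch q q p.2 * qPoch q q p.1))
      (qPochInf (q ^ 3) (q ^ 3) / qPochInf (q ^ 2) (q ^ 2)) := by
  have hS := hasSum_bilSum h0 hq (c := 0) (b := 4) zero_le_one (by norm_num) le_rfl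
  have hq3 : ‖q ^ 3‖ < 1 := by
    rw [norm_pow]
    exact pow_lt_one₀ (norm_nonneg _) hq three_ne_zero
  have ht := qPochInf_trisect hq3
  rw [← pow_mul, ← pow_mul] at ht
  norm_num at hS ht
  rw [ht] at hS
  refine hasSum_of_antidiagonal ?_ hS fun N => ?_
  · refine summable_double hq (fun p => add_le_exponent p.1 p.2 p.2) fun p => ?_
    have h1 : ∀ n, ‖q ^ n‖ ≤ 1 := fun n => by
      rw [norm_pow]
      exact pow_le_one₀ (norm_nonneg _) hq.le
    calc _ ≤ ‖(1 : ℂ)‖ + ‖q ^ p.1‖ + ‖q ^ (p.1 + p.2)‖ :=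
          (norm_add_le _ _).trans (by gcongr; exact norm_sub_le _ _)
      _ ≤ 4 := by rw [norm_one]; linarith [h1 p.1, h1 (p.1 + p.2)]
  · have h1 := sum_weighted_antidiagonal_eq_qPoch_div_mixedSum hq N 0
    simp only [zero_add, pow_one, add_zero] at h1
    rw [mixedSum_self_eq_bilSum h0 hq N] at h1
    rw [← h1, mul_sum]
    refine sum_congr rfl fun p hp => ?_
    obtain rfl := mem_antidiagonal.mp hp
    simp only [Prod.fst_swap, Prod.snd_swap]
    rw [show p.2 + p.1 = p.1 + p.2 by ring, show p.2 + 2 * p.1 = p.1 + p.2 + p.1 by ring]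
    ring

theorem hasSum_mod_nine_two_seven {q : ℂ} (h0 : q ≠ 0) (hq : ‖q‖ < 1) :
    HasSum (fun p : ℕ × ℕ =>
        q ^ (2 * p.1 ^ 2 + 3 * p.2 ^ 2 + 4 * p.1 * p.2 + 2 * p.1 + 3 * p.2) *
            (1 + q ^ (p.2 + 1) - q ^ (p.1 + p.2 + 1) + q ^ (p.1 + 2 * p.2 + 1)) /
          (qPoch (-q) q (p.1 + p.2) * qPoch (-q) q (p.1 + 2 * p.2 + 1) *
            qPoch q q p.2 * qPoch q q p.1))
      (qPochInf₃ (q ^ 2) (q ^ 7) (q ^ 9) (q ^ 9) / qPochInf (q ^ 2) (q ^ 2)) := by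
  have hS := hasSum_bilSum h0 hq (c := 1) (b := 3) le_rfl (by norm_num) (by norm_num)
  norm_num at hS
  refine hasSum_of_antidiagonal ?_ hS fun N => ?_
  · refine summable_double hq (fun p => (add_le_exponent p.1 p.2 (2 * p.1 + 3 * p.2)).trans_eq
      (add_assoc _ _ _).symm) fun p => ?_
    have h1 : ∀ n, ‖q ^ n‖ ≤ 1 := fun n => by
      rw [norm_pow]
      exact pow_le_one₀ (norm_nonneg _) hq.le
    calc _ ≤ ‖(1 : ℂ)‖ + ‖q ^ (p.2 + 1)‖ + ‖q ^ (p.1 + p.2 + 1)‖ + ‖q ^ (p.1 + 2 * p.2 + 1)‖ :=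
          (norm_add_le _ _).trans (by
            gcongr
            exact (norm_sub_le _ _).trans (by gcongr; exact norm_add_le _ _))
      _ ≤ 4 := by
        rw [norm_one]
        linarith [h1 (p.2 + 1), h1 (p.1 + p.2 + 1), h1 (p.1 + 2 * p.2 + 1)]
  · have h1 := sum_antidiagonal_eq_qPoch_div_mixedSum hq N 1
    -- The numerator is `1 + q · q^r (1 - q^n + q^N)`: the plain inner sum plus `q` times the
    -- weighted one.
    have h2 := sum_weighted_antidiagonal_eq_qPoch_div_mixedSum hq N 1
    have h3 := mixedSum_add_eq_bilSum h0 hq N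
    norm_num at h1 h2
    rw [← h1, ← h2, mul_sum, ← sum_add_distrib] at h3
    rw [← h3, mul_sum]
    refine sum_congr rfl fun p hp => ?_
    obtain rfl := mem_antidiagonal.mp hp
    simp only [Prod.fst_swap, Prod.snd_swap]
    rw [show p.2 + p.1 = p.1 + p.2 by ring, show p.2 + 2 * p.1 = p.1 + p.2 + p.1 by ring]
    ring

end

theorem mainTheorem4 (q : ℂ) (hq : ‖q‖ < 1) :
    HasSum (fun p : ℕ × ℕ =>
        q ^ (2 * p.1 ^ 2 + 3 * p.2 ^ 2 + 4 * p.1 * p.2 + 2 * p.1 + 3 * p.2) /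
          (qPoch (-q) q (p.1 + p.2) * qPoch (-q) q (p.1 + 2 * p.2 + 1) *
            qPoch q q p.2 * qPoch q q p.1))
      (qPochInf₃ q (q ^ 8) (q ^ 9) (q ^ 9) / qPochInf (q ^ 2) (q ^ 2)) ∧
    HasSum (fun p : ℕ × ℕ =>
        q ^ (2 * p.1 ^ 2 + 3 * p.2 ^ 2 + 4 * p.1 * p.2 + 2 * p.1 + 3 * p.2) *
            (1 + q ^ (p.2 + 1) - q ^ (p.1 + p.2 + 1) + q ^ (p.1 + 2 * p.2 + 1)) /
          (qPoch (-q) q (p.1 + p.2) * qPoch (-q) q (p.1 + 2 * p.2 + 1) *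
            qPoch q q p.2 * qPoch q q p.1))
      (qPochInf₃ (q ^ 2) (q ^ 7) (q ^ 9) (q ^ 9) / qPochInf (q ^ 2) (q ^ 2)) ∧
    HasSum (fun p : ℕ × ℕ =>
        q ^ (2 * p.1 ^ 2 + 3 * p.2 ^ 2 + 4 * p.1 * p.2 + p.2) *
            (1 - q ^ p.1 + q ^ (p.1 + p.2)) /
          (qPoch (-q) q (p.1 + p.2) * qPoch (-q) q (p.1 + 2 * p.2) *
            qPoch q q p.2 * qPoch q q p.1))
      (qPochInf (q ^ 3) (q ^ 3) / qPochInf (q ^ 2) (q ^ 2)) ∧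
    HasSum (fun p : ℕ × ℕ =>
        q ^ (2 * p.1 ^ 2 + 3 * p.2 ^ 2 + 4 * p.1 * p.2) /
          (qPoch (-q) q (p.1 + p.2) * qPoch (-q) q (p.1 + 2 * p.2) *
            qPoch q q p.2 * qPoch q q p.1))
      (qPochInf₃ (q ^ 4) (q ^ 5) (q ^ 9) (q ^ 9) / qPochInf (q ^ 2) (q ^ 2)) := by
  -- The bilateral argument uses negative powers of `q`. At `q = 0` only the term `n = r = 0`
  -- survives.
  rcases eq_or_ne q 0 with rfl | h0
  · have hE : ∀ p : ℕ × ℕ, 0 < p.1 + p.2 → ∀ l,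
        (0 : ℂ) ^ (2 * p.1 ^ 2 + 3 * p.2 ^ 2 + 4 * p.1 * p.2 + l) = 0 := fun p hp l =>
      zero_pow (hp.trans_le (add_le_exponent p.1 p.2 l)).ne'
    refine ⟨?_, ?_, ?_, ?_⟩ <;> refine hasSum_of_eq_zero (fun p hp => ?_) ?_
    · rw [add_assoc _ (2 * p.1), hE p hp, zero_div]
    · simp [qPochInf₃, qPochInf, qPoch]
    · rw [add_assoc _ (2 * p.1) (3 * p.2), hE p hp, zero_mul, zero_div]
    · simp [qPochInf₃, qPochInf, qPoch]
    · rw [hE p hp, zero_mul, zero_div]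
    · simp [qPochInf, qPoch]
    · have := hE p hp 0
      rw [add_zero] at this
      rw [this, zero_div]
    · simp [qPochInf₃, qPochInf, qPoch]
  · exact ⟨hasSum_mod_nine_one_eight h0 hq, hasSum_mod_nine_two_seven h0 hq, hasSum_mod_nine_three_six h0 hq, hasSum_mod_nine_four_five h0 hq⟩
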